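/- Let $N_U$ users and $N_I$ items be given, with a real prediction matrix $P=(P_{ij})$ and a real affinity matrix $Y=(Y_{ij})$ ($1\le i\le N_U$, $1\le j\le N_I$). For a finite set $S$ of items and $x,y\in\mathbb{R}^{N_I}$ let $$\mathrm{corr}_S(x,y)=\frac{\sum_{j\in S}(x_j-\bar x_S)(y_j-\bar y_S)}{\sqrt{\sum_{j\in S}(x_j-\bar x_S)^2\,\sum_{j\in S}(y_j-\bar y_S)^2}},\qquad \bar x_S=\frac1{|S|}\sum_{j\in S}x_j ,$$ with the value $0$ where $x$ or $y$ is constant on $S$, and let $\mathrm{corr}$ be the correlation over all items. Put $$L^{c}=\frac1{N_U}\sum_{i=1}^{N_U}\bigl(1-\mathrm{corr}(P_i,Y_i)\bigr),\qquad L^{c_S}=\frac1{|S_U|}\sum_{i\in S_U}\bigl(1-\mathrm{corr}_{S_I}(P_i,Y_i)\bigr)$$ for sets $S_U$ of users and $S_I$ of items. For an item $j$ let $\nabla_j L=(\partial L/\partial P_{ij})_{i}$ be the vector, indexed by the users, of partial derivatives with respect to the predictions for item $j$; a partial derivative that does not exist (which happens only for samples $S_I$ on which $P_i$ is constant) is counted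 as $0$. Let $S_U$ be a uniformly random set of $N_{S_U}$ users and $S_I$ a uniformly random set of $N_{S_I}$ items, where $1\le N_{S_U}\le N_U$ and $1\le N_{S_I}\le N_I$. Then $$\mathbb{E}_{S_U}\mathbb{E}_{S_I}\bigl[\nabla_j L^{c_S}\bigr]=\nabla_j L^{c}+\mathcal{O}(1/N_{S_I}),$$ uniformly in the following sense. For all real $B$ and all $\sigma,\delta>0$ there is a constant $C$, depending on $B,\sigma,\delta$ only, such that for all $N_U,N_I$ and all $P,Y$ with * $|P_{ij}|\le B$ and $|Y_{ij}|\le B$ for all $i,j$, * variance of each row $P_i$ and of each row $Y_i$ over all items at least $\sigma^2$, * $|P_{ia}-P_{ib}|\ge\delta$ whenever $P_{ia}\ne P_{ib}$, the following hold: $L^{c}$ is differentiable in the prediction matrix at $P$; $L^{c_S}$ is differentiable at $P$ for all $S_U,S_I$ such that no $P_i$ with $i\in S_U$ is constant on $S_I$; and for all $N_{S_U}$, $N_{S_I}$ as above, all items $j$ and all users $i$, $$\left|\mathbb{E}_{S_U}\mathbb{E}_{S_I}\!\left[\frac{\partial L^{c_S}}{\partial P_{ij}}\right]-\frac{\partial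 L^{c}}{\partial P_{ij}}\right|\le\frac{C}{N_U\,N_I\,N_{S_I}} .$$ (Any given matrices without constant rows satisfy the three conditions for some $B,\sigma,\delta$.) -/

import Mathlib

noncomputable section

namespace SampleCorr

/-- The arithmetic mean of `x` over the finite set `S`. -/
def mean {ι : Type*} (S : Finset ι) (x : ι → ℝ) : ℝ :=
  (∑ j ∈ S, x j) / (S.card : ℝ)

/-- The Pearson correlation of `x` and `y` over the finite set `S`. Where it is undefined
(`x` or `y` is constant on `S`) it takes the value `0`. -/
def corr {ι : Type*} (S : Finset ι) (x y : ι → ℝ) : ℝ :=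
  (∑ j ∈ S, (x j - mean S x) * (y j - mean S y)) /
    Real.sqrt ((∑ j ∈ S, (x j - mean S x) ^ 2) * (∑ j ∈ S, (y j - mean S y) ^ 2))

/-- The population variance of `x` over all items. -/
def variance {N : ℕ} (x : Fin N → ℝ) : ℝ :=
  mean Finset.univ (fun j => (x j - mean Finset.univ x) ^ 2)

/-- The full per-user correlation loss of the prediction matrix `P` against the affinity
matrix `Y` (rows are users, columns are items). -/
def fullLoss {NU NI : ℕ} (P Y : Fin NU → Fin NI → ℝ) : ℝ :=
  (∑ i, (1 - corr Finset.univ (P i) (Y i))) / (NU : ℝ)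

/-- The correlation loss computed from the users in `SU` and the items in `SI` only. -/
def sampleLoss {NU NI : ℕ} (SU : Finset (Fin NU)) (SI : Finset (Fin NI))
    (P Y : Fin NU → Fin NI → ℝ) : ℝ :=
  (∑ i ∈ SU, (1 - corr SI (P i) (Y i))) / (SU.card : ℝ)

/-- The item-`j` part of the gradient of a loss `L` with respect to the prediction matrix:
the vector, indexed by the users `i`, of the partial derivatives of `L` with respect to the
entry `P i j`, at the matrix `P`. -/
def grad {NU NI : ℕ} (j : Fin NI) (L : (Fin NU → Fin NI → ℝ) → ℝ)
    (P : Fin NU → Fin NI → ℝ) : Fin NU → ℝ :=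
  fun i => deriv (fun t : ℝ => L (Function.update P i (Function.update (P i) j t))) (P i j)

/-- The expectation of `f S` when `S` is a uniformly random `n`-element subset of `Fin N`. -/
def expect {N : ℕ} (n : ℕ) (f : Finset (Fin N) → ℝ) : ℝ :=
  (∑ S ∈ Finset.powersetCard n Finset.univ, f S) / (N.choose n : ℝ)

end SampleCorr

end

/-!
A user or an item outside the sample contributes no gradient, so by linearity everything reduces to
one user: writing `D S` for the partial derivative of `corr S x y` with respect to `x j`, the claim
is that the mean of `n * D S` over the `n`-element sets `S` containing `j` differs from `N * D univ`
by `O(1 / n)`.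

Now `#S * D S` is a smooth function `G` of the moments of `x` and `y` over `S` up to order two
(and of `x j`, `y j`). When `S` is drawn without replacement, conditioned on `j ∈ S`, the vector of
these moments has bias `O(1 / n)` and second and fourth central moments `O(1 / n)` and
`O(1 / n ^ 2)`, so a second order Taylor expansion of `G` at the moments over all items gives the
claim as long as the sample moments stay close to them. Far away `G` is singular, but the gap `δ`
between distinct entries of `x` yields `|n * D S| ≤ 2 * n / δ`, and since large deviations have
probability `O(1 / n ^ 2)` their contribution is `O(1 / n)` as well.
-/

namespace SampleCorr

open Finset
open scoped BigOperators InnerProductSpace Topology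

section Covariance

variable {ι : Type*} {S : Finset ι}

/-- The population covariance of `x` and `y` over the finite set `S`. -/
noncomputable def cov (S : Finset ι) (x y : ι → ℝ) : ℝ :=
  mean S fun k => (x k - mean S x) * (y k - mean S y)

theorem mean_eq_expect (S : Finset ι) (x : ι → ℝ) : mean S x = 𝔼 k ∈ S, x k :=
  (expect_eq_sum_div_card S x).symm

theorem mean_add (S : Finset ι) (x y : ι → ℝ) : mean S (x + y) = mean S x + mean S y := by
  simp only [mean_eq_expect, Pi.add_apply, expect_add_distrib]

theorem mean_smul (S : Finset ι) (c : ℝ) (x : ι → ℝ) : mean S (c • x) = c * mean S x := by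
  simp only [mean_eq_expect, Pi.smul_apply, smul_eq_mul, mul_expect]

theorem cov_eq_mean_mul_sub (S : Finset ι) (x y : ι → ℝ) :
    cov S x y = mean S (fun k => x k * y k) - mean S x * mean S y := by
  rcases S.eq_empty_or_nonempty with rfl | hS
  · simp [cov, mean]
  simp only [cov, mean_eq_expect, sub_mul, mul_sub, expect_sub_distrib, ← mul_expect, ← expect_mul,
    expect_const hS]
  ring

theorem cov_comm (S : Finset ι) (x y : ι → ℝ) : cov S x y = cov S y x := by
  simp only [cov, mul_comm]

theorem cov_add_left (S : Finset ι) (x z y : ι → ℝ) :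
    cov S (x + z) y = cov S x y + cov S z y := by
  rw [cov, cov, cov, ← mean_add, mean_add S x z]
  congr 1
  funext k
  simp only [Pi.add_apply]
  ring

theorem cov_smul_left (S : Finset ι) (c : ℝ) (x y : ι → ℝ) :
    cov S (c • x) y = c * cov S x y := by
  rw [cov, cov, ← mean_smul, mean_smul S c x]
  congr 1
  funext k
  simp only [Pi.smul_apply, smul_eq_mul]
  ring

theorem cov_add_right (S : Finset ι) (x y z : ι → ℝ) :
    cov S x (y + z) = cov S x y + cov S x z := by
  simp only [cov_comm S x, cov_add_left]

theorem cov_smul_right (S : Finset ι) (c : ℝ) (x y : ι → ℝ) :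
    cov S x (c • y) = c * cov S x y := by
  simp only [cov_comm S x, cov_smul_left]

theorem card_mul_cov (S : Finset ι) (x y : ι → ℝ) :
    #S * cov S x y = ∑ k ∈ S, (x k - mean S x) * (y k - mean S y) := by
  rw [cov, mean_eq_expect, card_mul_expect]

theorem cov_self_nonneg (S : Finset ι) (x : ι → ℝ) : 0 ≤ cov S x x := by
  rw [cov, mean_eq_expect]
  exact expect_nonneg fun k _ => mul_self_nonneg _

theorem cov_sq_le (S : Finset ι) (x y : ι → ℝ) : cov S x y ^ 2 ≤ cov S x x * cov S y y := by
  simp only [cov, mean_eq_expect, ← sq]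
  exact expect_mul_sq_le_sq_mul_sq S _ _

theorem cov_eq_zero_of_const_left {x : ι → ℝ} {c : ℝ} (hx : ∀ k ∈ S, x k = c) (y : ι → ℝ) :
    cov S x y = 0 := by
  have hmean : ∀ k ∈ S, mean S x = c := fun k hk => by
    rw [mean_eq_expect, expect_congr rfl hx, expect_const ⟨k, hk⟩]
  rw [cov, mean_eq_expect]
  exact expect_eq_zero fun k hk => by rw [hx k hk, hmean k hk, sub_self, zero_mul]

theorem sq_sub_le_two_mul_card_mul_cov_self {a b : ι} (ha : a ∈ S) (hb : b ∈ S) (x : ι → ℝ) :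
    (x a - x b) ^ 2 ≤ 2 * (#S * cov S x x) := by
  classical
  rcases eq_or_ne a b with rfl | hab
  · have := cov_self_nonneg S x
    rw [sub_self, zero_pow two_ne_zero]
    positivity
  have hpair : ∑ k ∈ {a, b}, (x k - mean S x) ^ 2 ≤ #S * cov S x x := by
    simp only [card_mul_cov, ← sq]
    exact sum_le_sum_of_subset_of_nonneg (by simp [insert_subset_iff, ha, hb])
      fun k _ _ => sq_nonneg _
  rw [sum_pair hab] at hpair
  linarith [sq_nonneg ((x a - mean S x) + (x b - mean S x))]

theorem cov_self_pos_of_ne {x : ι → ℝ} {a b : ι} (ha : a ∈ S) (hb : b ∈ S) (hab : x a ≠ x b) :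
    0 < cov S x x := by
  have hsep := sq_sub_le_two_mul_card_mul_cov_self ha hb x
  have hpos : 0 < (x a - x b) ^ 2 := sq_pos_of_ne_zero (sub_ne_zero.2 hab)
  exact pos_of_mul_pos_right (by linarith) (Nat.cast_nonneg #S)

theorem cov_single_left [DecidableEq ι] {j : ι} (hj : j ∈ S) (y : ι → ℝ) :
    cov S (Pi.single j 1) y = (y j - mean S y) / #S := by
  simp only [cov_eq_mean_mul_sub, mean, Pi.single_apply, ite_mul, one_mul, zero_mul,
    sum_ite_eq', hj, if_true]
  ring

theorem variance_eq_cov_self {N : ℕ} (x : Fin N → ℝ) : variance x = cov univ x x := by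
  simp only [variance, cov, sq]

end Covariance

section Correlation

variable {ι : Type*} {S : Finset ι}

theorem corr_eq_cov_div_sqrt (S : Finset ι) (x y : ι → ℝ) :
    corr S x y = cov S x y / √(cov S x x * cov S y y) := by
  rcases S.eq_empty_or_nonempty with rfl | hS
  · simp [corr, cov, mean]
  have hcard : (0 : ℝ) < #S := by exact_mod_cast hS.card_pos
  simp only [corr, sq, ← card_mul_cov]
  rw [mul_mul_mul_comm, Real.sqrt_mul (by positivity), Real.sqrt_mul_self hcard.le,
    mul_div_mul_left _ _ hcard.ne']

theorem corr_smul_left {c : ℝ} (hc : 0 < c) (x y : ι → ℝ) : corr S (c • x) y = corr S x y := by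
  simp only [corr_eq_cov_div_sqrt, cov_smul_left, cov_smul_right]
  rw [show c * (c * cov S x x) * cov S y y = c * c * (cov S x x * cov S y y) by ring,
    Real.sqrt_mul (by positivity), Real.sqrt_mul_self hc.le, mul_div_mul_left _ _ hc.ne']

theorem corr_add_left_of_const {x : ι → ℝ} {c : ℝ} (hx : ∀ k ∈ S, x k = c) (z y : ι → ℝ) :
    corr S (x + z) y = corr S z y := by
  simp only [corr_eq_cov_div_sqrt, cov_add_left, cov_add_right, cov_eq_zero_of_const_left hx,
    cov_comm S z x, zero_add]

theorem hasLineDerivAt_corr {x : ι → ℝ} (hx : 0 < cov S x x) (y v : ι → ℝ) :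
    HasLineDerivAt ℝ (corr S · y)
      ((cov S v y - cov S x y / cov S x x * cov S v x) / √(cov S x x * cov S y y)) x v := by
  rcases (cov_self_nonneg S y).eq_or_lt with hy | hy
  · simp only [HasLineDerivAt, corr_eq_cov_div_sqrt, ← hy, mul_zero, Real.sqrt_zero, div_zero]
    exact hasDerivAt_const _ _
  have hpos : 0 < cov S x x * cov S y y := mul_pos hx hy
  have hsqrt : √(cov S x x * cov S y y) ≠ 0 := (Real.sqrt_pos.2 hpos).ne'
  have hnum : HasDerivAt (fun t : ℝ => cov S (x + t • v) y) (cov S v y) 0 := by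
    simpa [cov_add_left, cov_smul_left] using
      ((hasDerivAt_id (0 : ℝ)).mul_const (cov S v y)).const_add (cov S x y)
  have hvar : HasDerivAt (fun t : ℝ => cov S (x + t • v) (x + t • v) * cov S y y)
      (2 * cov S v x * cov S y y) 0 := by
    have hquad : ∀ t : ℝ, cov S (x + t • v) (x + t • v)
        = cov S x x + 2 * cov S v x * t + cov S v v * t ^ 2 := fun t => by
      simp only [cov_add_left, cov_smul_left, cov_add_right, cov_smul_right, cov_comm S x v]
      ring
    have := ((((hasDerivAt_id (0 : ℝ)).const_mul (2 * cov S v x)).const_add (cov S x x)).add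
      (((hasDerivAt_id (0 : ℝ)).pow 2).const_mul (cov S v v))).mul_const (cov S y y)
    simpa [hquad] using this
  have hquot := hnum.div (hvar.sqrt (by simpa using hpos.ne')) (by simpa using hsqrt)
  simp only [HasLineDerivAt, corr_eq_cov_div_sqrt]
  refine hquot.congr_deriv ?_
  simp only [zero_smul, add_zero, Real.sq_sqrt hpos.le]
  have hsq := Real.sq_sqrt hpos.le
  set s := √(cov S x x * cov S y y)
  field_simp
  rw [hsq]
  field_simp

/-- The partial derivative of `corr S x y` with respect to the entry `x j`. -/
noncomputable def corrPartial [DecidableEq ι] (S : Finset ι) (x y : ι → ℝ) (j : ι) : ℝ :=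
  lineDeriv ℝ (corr S · y) x (Pi.single j 1)

-- The numerator of the derivative is the covariance of `v` with the residual of regressing `y` on
-- `x`, whose variance is at most that of `y`.
theorem lineDeriv_corr_sq_le {x : ι → ℝ} (hx : 0 < cov S x x) (y v : ι → ℝ) :
    lineDeriv ℝ (corr S · y) x v ^ 2 ≤ cov S v v / cov S x x := by
  rw [(hasLineDerivAt_corr hx y v).lineDeriv, div_pow,
    Real.sq_sqrt (mul_nonneg hx.le (cov_self_nonneg S y))]
  set β := cov S x y / cov S x x
  have hnum : cov S v y - β * cov S v x = cov S v (y + (-β) • x) := by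
    rw [cov_add_right, cov_smul_right]
    ring
  have hβx : β * cov S x x = cov S x y := div_mul_cancel₀ _ hx.ne'
  have hres : cov S (y + (-β) • x) (y + (-β) • x) ≤ cov S y y := by
    simp only [cov_add_left, cov_add_right, cov_smul_left, cov_smul_right, cov_comm S y x, ← hβx]
    nlinarith [mul_nonneg (sq_nonneg β) hx.le]
  rcases (cov_self_nonneg S y).eq_or_lt with hy | hy
  · rw [← hy, mul_zero, div_zero]
    exact div_nonneg (cov_self_nonneg S v) hx.le
  rw [hnum, div_le_div_iff₀ (mul_pos hx hy) hx]
  calc cov S v (y + (-β) • x) ^ 2 * cov S x x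
      ≤ cov S v v * cov S y y * cov S x x := by
        gcongr
        exact (cov_sq_le S v _).trans (by gcongr; exact cov_self_nonneg S v)
    _ = cov S v v * (cov S x x * cov S y y) := by ring

theorem deriv_zero_eq_zero_of_homogeneous {f : ℝ → ℝ} (hf : ∀ s > 0, ∀ t, f (s * t) = f t) :
    deriv f 0 = 0 := by
  by_cases hdiff : DifferentiableAt ℝ f 0
  swap
  · exact deriv_zero_of_not_differentiableAt hdiff
  have hconst : ∀ t, f t = f 0 := fun t => by
    have hlim : Filter.Tendsto (fun s : ℝ => f (s * t)) (𝓝[>] 0) (𝓝 (f 0)) := by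
      have hmul : Filter.Tendsto (fun s : ℝ => s * t) (𝓝[>] 0) (𝓝 0) := by
        simpa using ((continuous_mul_const t).tendsto 0).mono_left nhdsWithin_le_nhds
      exact hdiff.continuousAt.tendsto.comp hmul
    refine tendsto_nhds_unique (tendsto_const_nhds.congr' ?_) hlim
    filter_upwards [self_mem_nhdsWithin] with s hs using (hf s hs t).symm
  rw [funext hconst, deriv_const]

theorem lineDeriv_corr_of_const {x : ι → ℝ} {c : ℝ} (hx : ∀ k ∈ S, x k = c) (y v : ι → ℝ) :
    lineDeriv ℝ (corr S · y) x v = 0 := by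
  refine deriv_zero_eq_zero_of_homogeneous fun s hs t => ?_
  simp only [corr_add_left_of_const hx, mul_smul, corr_smul_left hs]

theorem corrPartial_of_notMem [DecidableEq ι] {j : ι} (hj : j ∉ S) (x y : ι → ℝ) :
    corrPartial S x y j = 0 := by
  have hsingle : ∀ t : ℝ, ∀ k ∈ S, (t • Pi.single j (1 : ℝ)) k = 0 := fun t k hk => by
    simp [ne_of_mem_of_not_mem hk hj]
  simp only [corrPartial, lineDeriv, add_comm x, corr_add_left_of_const (hsingle _), deriv_const]

theorem corrPartial_eq [DecidableEq ι] {x : ι → ℝ} (hx : 0 < cov S x x) {j : ι} (hj : j ∈ S)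
    (y : ι → ℝ) :
    #S * corrPartial S x y j =
      ((y j - mean S y) - cov S x y / cov S x x * (x j - mean S x)) /
        √(cov S x x * cov S y y) := by
  have hcard : (#S : ℝ) ≠ 0 := by exact_mod_cast (card_pos.2 ⟨j, hj⟩).ne'
  rw [corrPartial, (hasLineDerivAt_corr hx y _).lineDeriv, cov_single_left hj, cov_single_left hj]
  field_simp

theorem card_mul_cov_single_self_le_one [DecidableEq ι] {j : ι} (hj : j ∈ S) :
    #S * cov S (Pi.single j 1) (Pi.single j 1) ≤ 1 := by
  have hcard : (#S : ℝ) ≠ 0 := by exact_mod_cast (card_pos.2 ⟨j, hj⟩).ne'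
  have hmean : 0 ≤ mean S (Pi.single j (1 : ℝ)) := by
    rw [mean_eq_expect]
    exact expect_nonneg fun k _ => by
      rw [Pi.single_apply]
      split_ifs <;> norm_num
  rw [cov_single_left hj, mul_div_cancel₀ _ hcard, Pi.single_eq_same]
  linarith

theorem abs_corrPartial_le [DecidableEq ι] {δ : ℝ} (hδ : 0 < δ) {x : ι → ℝ}
    (hsep : ∀ a ∈ S, ∀ b ∈ S, x a ≠ x b → δ ≤ |x a - x b|) (y : ι → ℝ) (j : ι) :
    |corrPartial S x y j| ≤ 2 / δ := by
  by_cases hj : j ∉ S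
  · rw [corrPartial_of_notMem hj, abs_zero]
    positivity
  rw [not_not] at hj
  by_cases hconst : ∀ k ∈ S, x k = x j
  · rw [corrPartial, lineDeriv_corr_of_const hconst, abs_zero]
    positivity
  push Not at hconst
  obtain ⟨k, hk, hkj⟩ := hconst
  have hcard : (0 : ℝ) < #S := by exact_mod_cast card_pos.2 ⟨j, hj⟩
  have hvar : δ ^ 2 ≤ 2 * (#S * cov S x x) :=
    calc δ ^ 2 ≤ |x k - x j| ^ 2 := by gcongr; exact hsep k hk j hj hkj
      _ = (x k - x j) ^ 2 := sq_abs _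
      _ ≤ _ := sq_sub_le_two_mul_card_mul_cov_self hk hj x
  have hpos : 0 < cov S x x := cov_self_pos_of_ne hk hj hkj
  have hsingle := card_mul_cov_single_self_le_one hj
  refine abs_le_of_sq_le_sq ?_ (by positivity)
  calc corrPartial S x y j ^ 2
      ≤ cov S (Pi.single j 1) (Pi.single j 1) / cov S x x := lineDeriv_corr_sq_le hpos y _
    _ = #S * cov S (Pi.single j 1) (Pi.single j 1) / (#S * cov S x x) :=
        (mul_div_mul_left _ _ hcard.ne').symm
    _ ≤ 1 / (δ ^ 2 / 2) := by gcongr; linarith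
    _ ≤ (2 / δ) ^ 2 := by rw [div_pow, one_div_div]; gcongr; norm_num

theorem differentiableAt_corr [Finite ι] {x : ι → ℝ} (hx : 0 < cov S x x) (y : ι → ℝ) :
    DifferentiableAt ℝ (corr S · y) x := by
  have := Fintype.ofFinite ι
  simp only [corr_eq_cov_div_sqrt]
  rcases (cov_self_nonneg S y).eq_or_lt with hy | hy
  · simp only [← hy, mul_zero, Real.sqrt_zero, div_zero]
    exact differentiableAt_const _
  have hpos : 0 < cov S x x * cov S y y := mul_pos hx hy
  have hcov : DifferentiableAt ℝ (fun z => cov S z y) x := by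
    unfold cov mean
    fun_prop
  have hvar : DifferentiableAt ℝ (fun z => cov S z z) x := by
    unfold cov mean
    fun_prop
  have hsqrt := (hvar.mul_const (cov S y y)).sqrt hpos.ne'
  simp only [div_eq_mul_inv]
  exact hcov.fun_mul (hsqrt.fun_inv (Real.sqrt_pos.2 hpos).ne')

end Correlation

section VecMean

variable {κ V : Type*} [AddCommGroup V] [Module ℝ V]

/-- The arithmetic mean over `S` of a vector-valued function. Unlike `Finset.expect`, it only asks
for a real module structure. -/
noncomputable def vecMean (S : Finset κ) (F : κ → V) : V :=
  (#S : ℝ)⁻¹ • ∑ k ∈ S, F k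

theorem sum_sub_vecMean_univ [Fintype κ] (F : κ → V) :
    ∑ k, (F k - vecMean univ F) = 0 := by
  rcases isEmpty_or_nonempty κ with hκ | hκ
  · exact sum_of_isEmpty _
  rw [sum_sub_distrib, sum_const, ← Nat.cast_smul_eq_nsmul ℝ, vecMean,
    smul_inv_smul₀ (Nat.cast_ne_zero.2 Fintype.card_ne_zero), sub_self]

theorem vecMean_sub_eq {S : Finset κ} (hS : S.Nonempty) (F : κ → V) (c : V) :
    vecMean S F - c = (#S : ℝ)⁻¹ • ∑ k ∈ S, (F k - c) := by
  rw [sum_sub_distrib, sum_const, ← Nat.cast_smul_eq_nsmul ℝ, smul_sub,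
    inv_smul_smul₀ (Nat.cast_ne_zero.2 hS.card_ne_zero), vecMean]

theorem norm_vecMean_le {W : Type*} [NormedAddCommGroup W] [NormedSpace ℝ W] {S : Finset κ}
    (hS : S.Nonempty) {F : κ → W} {M : ℝ} (hF : ∀ k ∈ S, ‖F k‖ ≤ M) : ‖vecMean S F‖ ≤ M := by
  have hcard : (0 : ℝ) < #S := by exact_mod_cast hS.card_pos
  rw [vecMean, norm_smul, norm_inv, Real.norm_natCast, inv_mul_le_iff₀ hcard, ← nsmul_eq_mul]
  exact norm_sum_le_of_le S hF |>.trans_eq (sum_const M)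

end VecMean

section Sampling

variable {α : Type*} [Fintype α] [DecidableEq α]

/-- The `n`-element sets containing `j`: averaging over them is sampling without replacement,
conditioned on drawing `j`. -/
def setsThrough (j : α) (n : ℕ) : Finset (Finset α) :=
  (powersetCard n univ).filter (j ∈ ·)

theorem mem_setsThrough {j : α} {n : ℕ} {S : Finset α} :
    S ∈ setsThrough j n ↔ #S = n ∧ j ∈ S := by
  simp [setsThrough]

theorem setsThrough_one (j : α) : setsThrough j 1 = {{j}} := by
  ext S
  rw [mem_setsThrough, mem_singleton, card_eq_one]
  constructor
  · rintro ⟨⟨a, rfl⟩, hj⟩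
    rw [mem_singleton.1 hj]
  · rintro rfl
    exact ⟨⟨j, rfl⟩, mem_singleton_self j⟩

theorem card_mul_card_setsThrough (j : α) {n : ℕ} (hn : 1 ≤ n) :
    Fintype.card α * #(setsThrough j n) = n * (Fintype.card α).choose n := by
  obtain ⟨n, rfl⟩ := Nat.exists_eq_succ_of_ne_zero (Nat.one_le_iff_ne_zero.1 hn)
  obtain ⟨N, hN⟩ := Nat.exists_eq_succ_of_ne_zero (Fintype.card_pos_iff.2 ⟨j⟩).ne'
  have hcard := card_filter_powersetCard_subset {j} univ (n + 1) (subset_univ _) (by simp)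
  simp only [singleton_subset_iff, card_singleton, card_univ, hN] at hcard
  rw [setsThrough, hcard, hN]
  exact (Nat.add_one_mul_choose_eq N n).trans (mul_comm _ _)

theorem setsThrough_nonempty (j : α) {n : ℕ} (hn : 1 ≤ n) (hnN : n ≤ Fintype.card α) :
    (setsThrough j n).Nonempty := by
  rw [← card_pos]
  refine Nat.pos_of_mul_pos_left (a := Fintype.card α) ?_
  rw [card_mul_card_setsThrough j hn]
  exact Nat.mul_pos hn (Nat.choose_pos hnN)

theorem sum_setsThrough_succ (j : α) (n : ℕ) (h : Finset α → ℝ) :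
    n * ∑ S ∈ setsThrough j (n + 1), h S = ∑ S ∈ setsThrough j n, ∑ a ∈ Sᶜ, h (insert a S) := by
  have herase : n * ∑ S ∈ setsThrough j (n + 1), h S
      = ∑ S ∈ setsThrough j (n + 1), ∑ _a ∈ S.erase j, h S := by
    rw [mul_sum]
    refine sum_congr rfl fun S hS => ?_
    obtain ⟨hcard, hj⟩ := mem_setsThrough.1 hS
    rw [sum_const, card_erase_of_mem hj, hcard, nsmul_eq_mul, Nat.add_sub_cancel]
  rw [herase, sum_sigma', sum_sigma']
  refine sum_nbij' (fun p => ⟨p.1.erase p.2, p.2⟩) (fun p => ⟨insert p.2 p.1, p.2⟩) ?_ ?_ ?_ ?_ ?_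
    <;> rintro ⟨S, a⟩ hp
    <;> simp only [mem_sigma, mem_setsThrough, mem_erase, mem_compl] at hp ⊢
  · obtain ⟨⟨hcard, hj⟩, haj, ha⟩ := hp
    exact ⟨⟨by rw [card_erase_of_mem ha, hcard, Nat.add_sub_cancel], haj.symm, hj⟩, by simp⟩
  · obtain ⟨⟨hcard, hj⟩, ha⟩ := hp
    exact ⟨⟨by rw [card_insert_of_notMem ha, hcard], mem_insert_of_mem hj⟩,
      (ne_of_mem_of_not_mem hj ha).symm, mem_insert_self a S⟩
  · rw [insert_erase hp.2.2]
  · rw [erase_insert hp.2]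
  · rw [insert_erase hp.2.2]

theorem expect_setsThrough_succ (j : α) {n : ℕ} (hn : 1 ≤ n) (h : Finset α → ℝ) :
    𝔼 S ∈ setsThrough j (n + 1), h S = 𝔼 S ∈ setsThrough j n, 𝔼 a ∈ Sᶜ, h (insert a S) := by
  have hn' : (n : ℝ) ≠ 0 := by exact_mod_cast Nat.one_le_iff_ne_zero.1 hn
  set r : ℝ := ((Fintype.card α - n : ℕ) : ℝ)
  have hcompl : ∀ S ∈ setsThrough j n, (#Sᶜ : ℝ) = r := fun S hS => by
    rw [card_compl, (mem_setsThrough.1 hS).1]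
  have hcard : n * (#(setsThrough j (n + 1)) : ℝ) = #(setsThrough j n) * r := by
    have := sum_setsThrough_succ j n fun _ => 1
    simpa only [sum_const, nsmul_eq_mul, mul_one, sum_congr rfl hcompl] using this
  calc 𝔼 S ∈ setsThrough j (n + 1), h S
      = (∑ S ∈ setsThrough j n, ∑ a ∈ Sᶜ, h (insert a S)) / (#(setsThrough j n) * r) := by
        rw [← sum_setsThrough_succ, ← hcard, mul_div_mul_left _ _ hn', expect_eq_sum_div_card]
    _ = 𝔼 S ∈ setsThrough j n, 𝔼 a ∈ Sᶜ, h (insert a S) := by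
        rw [mul_comm, ← div_div, sum_div, expect_eq_sum_div_card]
        congr 1
        exact sum_congr rfl fun S hS => by rw [expect_eq_sum_div_card, hcompl S hS]

theorem expect_const_le {κ : Type*} (s : Finset κ) {c : ℝ} (hc : 0 ≤ c) : 𝔼 _k ∈ s, c ≤ c := by
  rcases s.eq_empty_or_nonempty with rfl | hs
  · rwa [expect_empty]
  · rw [expect_const hs]

theorem abs_expect_sum_setsThrough_le {b : α → ℝ} {M : ℝ} (hsum : ∑ k, b k = 0)
    (hM : ∀ k, |b k| ≤ M) (j : α) {n : ℕ} (hn : 1 ≤ n) :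
    |𝔼 S ∈ setsThrough j n, ∑ k ∈ S, b k| ≤ M := by
  induction n, hn using Nat.le_induction with
  | base => simpa [setsThrough_one] using hM j
  | succ n hn ih =>
    set r : ℝ := ((Fintype.card α - n : ℕ) : ℝ) with hr
    have hstep : ∀ S ∈ setsThrough j n,
        𝔼 a ∈ Sᶜ, ∑ k ∈ insert a S, b k = (r - 1) / r * ∑ k ∈ S, b k := fun S hS => by
      have hcompl : (#Sᶜ : ℝ) = r := by rw [card_compl, (mem_setsThrough.1 hS).1]
      rw [expect_eq_sum_div_card, sum_congr rfl fun a ha => sum_insert (mem_compl.1 ha),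
        sum_add_distrib, sum_const, nsmul_eq_mul, hcompl]
      linear_combination (r⁻¹) * (sum_compl_add_sum S b).trans hsum
    have hfactor : |(r - 1) / r| ≤ 1 := by
      rcases Nat.eq_zero_or_pos (Fintype.card α - n) with h0 | hpos
      · simp [hr, h0]
      · have hr1 : (1 : ℝ) ≤ r := Nat.one_le_cast.2 hpos
        rw [abs_div, abs_of_nonneg (by linarith), abs_of_nonneg (by linarith)]
        exact div_le_one_of_le₀ (by linarith) (by linarith)
    rw [expect_setsThrough_succ j hn, expect_congr rfl hstep, ← mul_expect, abs_mul]
    exact (mul_le_of_le_one_left (abs_nonneg _) hfactor).trans ih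

variable {E : Type*} [NormedAddCommGroup E] [InnerProductSpace ℝ E] {x : α → E}

-- The items outside `S` sum to the opposite of those in `S`, so that the next draw is negatively
-- correlated with the current sum.
theorem expect_compl_le_of_le_add_inner (hsum : ∑ k, x k = 0) {S : Finset α} {h : α → ℝ}
    {c d : ℝ} (hc : 0 ≤ c) (hd : 0 ≤ d)
    (hle : ∀ a ∈ Sᶜ, h a ≤ c + d * ⟪∑ k ∈ S, x k, x a⟫_ℝ) : 𝔼 a ∈ Sᶜ, h a ≤ c := by
  have hinner : 𝔼 a ∈ Sᶜ, ⟪∑ k ∈ S, x k, x a⟫_ℝ ≤ 0 := by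
    rw [expect_eq_sum_div_card, ← inner_sum,
      eq_neg_of_add_eq_zero_left ((sum_compl_add_sum S x).trans hsum), inner_neg_right,
      real_inner_self_eq_norm_sq]
    exact div_nonpos_of_nonpos_of_nonneg (neg_nonpos.2 (sq_nonneg _)) (Nat.cast_nonneg _)
  calc 𝔼 a ∈ Sᶜ, h a ≤ 𝔼 a ∈ Sᶜ, (c + d * ⟪∑ k ∈ S, x k, x a⟫_ℝ) := expect_le_expect hle
    _ = 𝔼 _a ∈ Sᶜ, c + d * 𝔼 a ∈ Sᶜ, ⟪∑ k ∈ S, x k, x a⟫_ℝ := by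
        rw [expect_add_distrib, ← mul_expect]
    _ ≤ c := by linarith [expect_const_le Sᶜ hc, mul_nonpos_of_nonneg_of_nonpos hd hinner]

theorem expect_compl_norm_sq_le {M : ℝ} (hsum : ∑ k, x k = 0) (hM : ∀ k, ‖x k‖ ≤ M)
    (S : Finset α) :
    𝔼 a ∈ Sᶜ, ‖∑ k ∈ insert a S, x k‖ ^ 2 ≤ ‖∑ k ∈ S, x k‖ ^ 2 + M ^ 2 := by
  refine expect_compl_le_of_le_add_inner (d := 2) hsum (by positivity) zero_le_two fun a ha => ?_
  rw [sum_insert (mem_compl.1 ha), add_comm, norm_add_sq_real]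
  have : ‖x a‖ ^ 2 ≤ M ^ 2 := by gcongr; exact hM a
  linarith

theorem norm_add_pow_four_le {u v : E} {M : ℝ} (hv : ‖v‖ ≤ M) :
    ‖u + v‖ ^ 4 ≤ ‖u‖ ^ 4 + 8 * M ^ 2 * ‖u‖ ^ 2 + 3 * M ^ 4 + 4 * ‖u‖ ^ 2 * ⟪u, v⟫_ℝ := by
  have hsq : ‖v‖ ^ 2 ≤ M ^ 2 := by gcongr
  have hinner : |⟪u, v⟫_ℝ| ≤ ‖u‖ * M :=
    (abs_real_inner_le_norm u v).trans (by gcongr)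
  have hinner_sq : ⟪u, v⟫_ℝ ^ 2 ≤ ‖u‖ ^ 2 * M ^ 2 := by
    rw [← mul_pow, ← sq_abs]
    gcongr
  have hcross : 4 * ⟪u, v⟫_ℝ * ‖v‖ ^ 2 ≤ 2 * M ^ 2 * ‖u‖ ^ 2 + 2 * M ^ 4 :=
    calc 4 * ⟪u, v⟫_ℝ * ‖v‖ ^ 2 ≤ 4 * (‖u‖ * M) * M ^ 2 := by
          have hM : 0 ≤ M := (norm_nonneg v).trans hv
          gcongr
          exact (le_abs_self _).trans hinner
      _ ≤ 2 * M ^ 2 * ‖u‖ ^ 2 + 2 * M ^ 4 := by nlinarith [sq_nonneg (M * (‖u‖ - M))]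
  have hquad : ‖u‖ ^ 2 * ‖v‖ ^ 2 ≤ ‖u‖ ^ 2 * M ^ 2 := by gcongr
  have hquart : (‖v‖ ^ 2) ^ 2 ≤ (M ^ 2) ^ 2 := by gcongr
  calc ‖u + v‖ ^ 4 = (‖u‖ ^ 2 + 2 * ⟪u, v⟫_ℝ + ‖v‖ ^ 2) ^ 2 := by rw [← norm_add_sq_real]; ring
    _ ≤ _ := by linarith

theorem expect_compl_norm_pow_four_le {M : ℝ} (hsum : ∑ k, x k = 0) (hM : ∀ k, ‖x k‖ ≤ M)
    (S : Finset α) :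
    𝔼 a ∈ Sᶜ, ‖∑ k ∈ insert a S, x k‖ ^ 4
      ≤ ‖∑ k ∈ S, x k‖ ^ 4 + 8 * M ^ 2 * ‖∑ k ∈ S, x k‖ ^ 2 + 3 * M ^ 4 := by
  refine expect_compl_le_of_le_add_inner (d := 4 * ‖∑ k ∈ S, x k‖ ^ 2) hsum (by positivity)
    (by positivity) fun a ha => ?_
  rw [sum_insert (mem_compl.1 ha), add_comm]
  exact norm_add_pow_four_le (hM a)

theorem expect_norm_sum_sq_le {M : ℝ} (hsum : ∑ k, x k = 0) (hM : ∀ k, ‖x k‖ ≤ M) (j : α)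
    {n : ℕ} (hn : 1 ≤ n) : 𝔼 S ∈ setsThrough j n, ‖∑ k ∈ S, x k‖ ^ 2 ≤ n * M ^ 2 := by
  induction n, hn using Nat.le_induction with
  | base => simpa [setsThrough_one] using pow_le_pow_left₀ (norm_nonneg _) (hM j) 2
  | succ n hn ih =>
    calc 𝔼 S ∈ setsThrough j (n + 1), ‖∑ k ∈ S, x k‖ ^ 2
        ≤ 𝔼 S ∈ setsThrough j n, (‖∑ k ∈ S, x k‖ ^ 2 + M ^ 2) := by
          rw [expect_setsThrough_succ j hn]
          exact expect_le_expect fun S _ => expect_compl_norm_sq_le hsum hM S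
      _ ≤ n * M ^ 2 + M ^ 2 := by
          rw [expect_add_distrib]
          exact add_le_add ih (expect_const_le _ (sq_nonneg M))
      _ = (n + 1 : ℕ) * M ^ 2 := by push_cast; ring

theorem expect_norm_sum_pow_four_le {M : ℝ} (hsum : ∑ k, x k = 0) (hM : ∀ k, ‖x k‖ ≤ M) (j : α)
    {n : ℕ} (hn : 1 ≤ n) :
    𝔼 S ∈ setsThrough j n, ‖∑ k ∈ S, x k‖ ^ 4 ≤ 4 * n ^ 2 * M ^ 4 := by
  induction n, hn using Nat.le_induction with
  | base =>
    have := pow_le_pow_left₀ (norm_nonneg _) (hM j) 4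
    simp only [setsThrough_one, expect_singleton, sum_singleton]
    norm_num
    linarith [pow_nonneg (norm_nonneg (x j)) 4]
  | succ n hn ih =>
    have hM4 : 0 ≤ M ^ 4 := by positivity
    calc 𝔼 S ∈ setsThrough j (n + 1), ‖∑ k ∈ S, x k‖ ^ 4
        ≤ 𝔼 S ∈ setsThrough j n,
            (‖∑ k ∈ S, x k‖ ^ 4 + 8 * M ^ 2 * ‖∑ k ∈ S, x k‖ ^ 2 + 3 * M ^ 4) := by
          rw [expect_setsThrough_succ j hn]
          exact expect_le_expect fun S _ => expect_compl_norm_pow_four_le hsum hM S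
      _ ≤ 4 * n ^ 2 * M ^ 4 + 8 * M ^ 2 * (n * M ^ 2) + 3 * M ^ 4 := by
          rw [expect_add_distrib, expect_add_distrib, ← mul_expect]
          gcongr
          · exact expect_norm_sum_sq_le hsum hM j hn
          · exact expect_const_le _ (by positivity)
      _ ≤ 4 * (n + 1 : ℕ) ^ 2 * M ^ 4 := by push_cast; linarith

theorem vecMean_sub_of_mem_setsThrough {V : Type*} [AddCommGroup V] [Module ℝ V] {j : α} {n : ℕ}
    {S : Finset α} (hS : S ∈ setsThrough j n) (F : α → V) (c : V) :
    vecMean S F - c = (n : ℝ)⁻¹ • ∑ k ∈ S, (F k - c) := by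
  obtain ⟨hcard, hj⟩ := mem_setsThrough.1 hS
  rw [vecMean_sub_eq ⟨j, hj⟩, hcard]

theorem abs_expect_clm_vecMean_sub_le {V : Type*} [NormedAddCommGroup V] [NormedSpace ℝ V]
    (L : V →L[ℝ] ℝ) {F : α → V} {M : ℝ} (hF : ∀ k, ‖F k - vecMean univ F‖ ≤ M) (j : α) {n : ℕ}
    (hn : 1 ≤ n) :
    |𝔼 S ∈ setsThrough j n, L (vecMean S F - vecMean univ F)| ≤ ‖L‖ * M / n := by
  have hlin : ∀ S ∈ setsThrough j n, L (vecMean S F - vecMean univ F)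
      = (n : ℝ)⁻¹ * ∑ k ∈ S, L (F k - vecMean univ F) := fun S hS => by
    rw [vecMean_sub_of_mem_setsThrough hS, map_smul, map_sum, smul_eq_mul]
  rw [expect_congr rfl hlin, ← mul_expect, abs_mul, abs_of_nonneg (by positivity), inv_mul_eq_div]
  gcongr
  refine abs_expect_sum_setsThrough_le ?_ (fun k => ?_) j hn
  · rw [← map_sum, sum_sub_vecMean_univ, map_zero]
  · exact (L.le_opNorm _).trans (by gcongr; exact hF k)

theorem expect_norm_vecMean_sub_sq_le {F : α → E} {M : ℝ}
    (hF : ∀ k, ‖F k - vecMean univ F‖ ≤ M) (j : α) {n : ℕ} (hn : 1 ≤ n) :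
    𝔼 S ∈ setsThrough j n, ‖vecMean S F - vecMean univ F‖ ^ 2 ≤ M ^ 2 / n := by
  have hnorm : ∀ S ∈ setsThrough j n, ‖vecMean S F - vecMean univ F‖ ^ 2
      = ((n : ℝ) ^ 2)⁻¹ * ‖∑ k ∈ S, (F k - vecMean univ F)‖ ^ 2 := fun S hS => by
    rw [vecMean_sub_of_mem_setsThrough hS, norm_smul, norm_inv, Real.norm_natCast, mul_pow,
      inv_pow]
  rw [expect_congr rfl hnorm, ← mul_expect]
  calc ((n : ℝ) ^ 2)⁻¹ * 𝔼 S ∈ setsThrough j n, ‖∑ k ∈ S, (F k - vecMean univ F)‖ ^ 2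
      ≤ ((n : ℝ) ^ 2)⁻¹ * (n * M ^ 2) := by
        gcongr
        exact expect_norm_sum_sq_le (sum_sub_vecMean_univ F) hF j hn
    _ = M ^ 2 / n := by field_simp

theorem expect_norm_vecMean_sub_pow_four_le {F : α → E} {M : ℝ}
    (hF : ∀ k, ‖F k - vecMean univ F‖ ≤ M) (j : α) {n : ℕ} (hn : 1 ≤ n) :
    𝔼 S ∈ setsThrough j n, ‖vecMean S F - vecMean univ F‖ ^ 4 ≤ 4 * M ^ 4 / n ^ 2 := by
  have hnorm : ∀ S ∈ setsThrough j n, ‖vecMean S F - vecMean univ F‖ ^ 4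
      = ((n : ℝ) ^ 4)⁻¹ * ‖∑ k ∈ S, (F k - vecMean univ F)‖ ^ 4 := fun S hS => by
    rw [vecMean_sub_of_mem_setsThrough hS, norm_smul, norm_inv, Real.norm_natCast, mul_pow,
      inv_pow]
  rw [expect_congr rfl hnorm, ← mul_expect]
  calc ((n : ℝ) ^ 4)⁻¹ * 𝔼 S ∈ setsThrough j n, ‖∑ k ∈ S, (F k - vecMean univ F)‖ ^ 4
      ≤ ((n : ℝ) ^ 4)⁻¹ * (4 * n ^ 2 * M ^ 4) := by
        gcongr
        exact expect_norm_sum_pow_four_le (sum_sub_vecMean_univ F) hF j hn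
    _ = 4 * M ^ 4 / n ^ 2 := by field_simp

theorem abs_expect_le_of_abs_le_norm_vecMean_sub {F : α → E} {M A : ℝ}
    (hF : ∀ k, ‖F k - vecMean univ F‖ ≤ M) {j : α} {n : ℕ} (hn : 1 ≤ n) (hA : 0 ≤ A)
    {e : Finset α → ℝ} (he : ∀ S ∈ setsThrough j n,
      |e S| ≤ A * (‖vecMean S F - vecMean univ F‖ ^ 2 + n * ‖vecMean S F - vecMean univ F‖ ^ 4)) :
    |𝔼 S ∈ setsThrough j n, e S| ≤ A * (M ^ 2 + 4 * M ^ 4) / n := by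
  calc |𝔼 S ∈ setsThrough j n, e S| ≤ 𝔼 S ∈ setsThrough j n, |e S| := abs_expect_le _ _
    _ ≤ 𝔼 S ∈ setsThrough j n,
          A * (‖vecMean S F - vecMean univ F‖ ^ 2 + n * ‖vecMean S F - vecMean univ F‖ ^ 4) :=
        expect_le_expect he
    _ ≤ A * (M ^ 2 / n + n * (4 * M ^ 4 / n ^ 2)) := by
        rw [← mul_expect, expect_add_distrib, ← mul_expect]
        gcongr
        · exact expect_norm_vecMean_sub_sq_le hF j hn
        · exact expect_norm_vecMean_sub_pow_four_le hF j hn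
    _ = A * (M ^ 2 + 4 * M ^ 4) / n := by field_simp

end Sampling

section DeltaMethod

theorem norm_sub_sub_fderiv_le_of_norm_fderiv_fderiv_le {V W : Type*} [NormedAddCommGroup V]
    [NormedSpace ℝ V] [NormedAddCommGroup W] [NormedSpace ℝ W] {f : V → W} {s : Set V} {C : ℝ}
    (hs : Convex ℝ s) (hf : ∀ z ∈ s, DifferentiableAt ℝ f z)
    (hf' : ∀ z ∈ s, DifferentiableAt ℝ (fderiv ℝ f) z)
    (hC : ∀ z ∈ s, ‖fderiv ℝ (fderiv ℝ f) z‖ ≤ C) {x y : V} (hx : x ∈ s) (hy : y ∈ s) :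
    ‖f y - f x - fderiv ℝ f x (y - x)‖ ≤ C * ‖y - x‖ ^ 2 := by
  have hseg : segment ℝ x y ⊆ s := hs.segment_subset hx hy
  have hlip : ∀ z ∈ segment ℝ x y, ‖fderiv ℝ f z - fderiv ℝ f x‖ ≤ C * ‖y - x‖ := fun z hz =>
    calc ‖fderiv ℝ f z - fderiv ℝ f x‖ ≤ C * ‖z - x‖ :=
          hs.norm_image_sub_le_of_norm_fderiv_le hf' hC hx (hseg hz)
      _ ≤ C * ‖y - x‖ := by
          have hC0 : 0 ≤ C := (norm_nonneg (fderiv ℝ (fderiv ℝ f) x)).trans (hC x hx)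
          gcongr
          exact norm_sub_le_of_mem_segment hz
  calc ‖f y - f x - fderiv ℝ f x (y - x)‖ ≤ C * ‖y - x‖ * ‖y - x‖ :=
        (convex_segment x y).norm_image_sub_le_of_norm_fderiv_le' (fun z hz => hf z (hseg hz)) hlip
          (left_mem_segment ℝ x y) (right_mem_segment ℝ x y)
    _ = C * ‖y - x‖ ^ 2 := by ring

theorem exists_uniform_taylor_bound {V : Type*} [NormedAddCommGroup V] [NormedSpace ℝ V]
    [ProperSpace V] {G : V → ℝ} {Ω K : Set V} (hΩ : IsOpen Ω) (hK : IsCompact K) (hKΩ : K ⊆ Ω)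
    (hG : ContDiffOn ℝ 2 G Ω) :
    ∃ ε > 0, ∃ C ≥ 0, ∀ μ ∈ K, |G μ| ≤ C ∧ ‖fderiv ℝ G μ‖ ≤ C ∧
      ∀ m ∈ Metric.closedBall μ ε,
        m ∈ Ω ∧ |G m - G μ - fderiv ℝ G μ (m - μ)| ≤ C * ‖m - μ‖ ^ 2 := by
  obtain ⟨ε, hε, hsub⟩ := hK.exists_cthickening_subset_open hΩ hKΩ
  have hG' : ContDiffOn ℝ 1 (fderiv ℝ G) Ω := hG.fderiv_of_isOpen hΩ (by norm_num)
  have hG'' : ContinuousOn (fderiv ℝ (fderiv ℝ G)) Ω := hG'.continuousOn_fderiv_of_isOpen hΩ le_rfl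
  obtain ⟨C₀, hC₀⟩ := hK.exists_bound_of_continuousOn (hG.continuousOn.mono hKΩ)
  obtain ⟨C₁, hC₁⟩ := hK.exists_bound_of_continuousOn (hG'.continuousOn.mono hKΩ)
  obtain ⟨C₂, hC₂⟩ := hK.cthickening.exists_bound_of_continuousOn
    (E := V →L[ℝ] V →L[ℝ] ℝ) (f := fderiv ℝ (fderiv ℝ G)) (hG''.mono hsub)
  have hdiff : ∀ z ∈ Ω, DifferentiableAt ℝ G z := fun z hz =>
    (hG.differentiableOn two_ne_zero).differentiableAt (hΩ.mem_nhds hz)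
  have hdiff' : ∀ z ∈ Ω, DifferentiableAt ℝ (fderiv ℝ G) z := fun z hz =>
    (hG'.differentiableOn one_ne_zero).differentiableAt (hΩ.mem_nhds hz)
  refine ⟨ε, hε, max 0 (max C₀ (max C₁ C₂)), le_max_left _ _, fun μ hμ => ⟨?_, ?_, fun m hm => ?_⟩⟩
  · exact (hC₀ μ hμ).trans (by simp)
  · exact (hC₁ μ hμ).trans (by simp)
  have hball := Metric.closedBall_subset_cthickening hμ ε
  refine ⟨hsub (hball hm), ?_⟩
  exact norm_sub_sub_fderiv_le_of_norm_fderiv_fderiv_le (convex_closedBall μ ε)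
    (fun z hz => hdiff z (hsub (hball hz))) (fun z hz => hdiff' z (hsub (hball hz)))
    (fun z hz => (hC₂ z (hball hz)).trans (by simp)) (Metric.mem_closedBall_self hε.le) hm

-- Outside a fixed ball around `μ` each term of the remainder is compared, as in Chebyshev's
-- inequality, with a power of `‖m - μ‖`; a fourth power is affordable for the large term `g`.
theorem exists_global_taylor_remainder_bound {V : Type*} [NormedAddCommGroup V] [NormedSpace ℝ V]
    [ProperSpace V] {G : V → ℝ} {Ω K : Set V} (hΩ : IsOpen Ω) (hK : IsCompact K) (hKΩ : K ⊆ Ω)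
    (hG : ContDiffOn ℝ 2 G Ω) {R : ℝ} (hR : 0 ≤ R) :
    ∃ A ≥ 0, ∀ μ ∈ K, ‖fderiv ℝ G μ‖ ≤ A ∧
      ∀ (n : ℕ) (m : V) (g : ℝ), |g| ≤ R * n → (m ∈ Ω → g = G m) →
        |g - G μ - fderiv ℝ G μ (m - μ)| ≤ A * (‖m - μ‖ ^ 2 + n * ‖m - μ‖ ^ 4) := by
  obtain ⟨ε, hε, C, hC, htaylor⟩ := exists_uniform_taylor_bound hΩ hK hKΩ hG
  set A : ℝ := C + C / ε + C / ε ^ 2 + R / ε ^ 4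
  have hCA : C ≤ A := by
    have : 0 ≤ C / ε + C / ε ^ 2 + R / ε ^ 4 := by positivity
    linarith
  refine ⟨A, hC.trans hCA, fun μ hμ => ?_⟩
  obtain ⟨hGμ, hG'μ, hnear⟩ := htaylor μ hμ
  refine ⟨hG'μ.trans hCA, fun n m g hg hgG => ?_⟩
  by_cases hm : m ∈ Metric.closedBall μ ε
  · obtain ⟨hmΩ, hmG⟩ := hnear m hm
    rw [hgG hmΩ]
    exact hmG.trans (mul_le_mul hCA (le_add_of_nonneg_right (by positivity)) (by positivity)
      (hC.trans hCA))
  set r := ‖m - μ‖ with hr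
  have hεr : 1 ≤ r / ε := by
    rw [one_le_div hε, hr, ← dist_eq_norm]
    exact (not_le.1 hm).le
  have hlin : |fderiv ℝ G μ (m - μ)| ≤ C * r := ((fderiv ℝ G μ).le_of_opNorm_le hG'μ _)
  calc |g - G μ - fderiv ℝ G μ (m - μ)| ≤ |g| + |G μ| + |fderiv ℝ G μ (m - μ)| :=
        (abs_sub _ _).trans (add_le_add_left (abs_sub _ _) _)
    _ ≤ R * n * (r / ε) ^ 4 + C * (r / ε) ^ 2 + C * r * (r / ε) := by
        gcongr
        · exact hg.trans (le_mul_of_one_le_right (by positivity) (one_le_pow₀ hεr))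
        · exact hGμ.trans (le_mul_of_one_le_right hC (one_le_pow₀ hεr))
        · exact hlin.trans (le_mul_of_one_le_right (by positivity) hεr)
    _ = R / ε ^ 4 * (n * r ^ 4) + (C / ε + C / ε ^ 2) * r ^ 2 := by ring
    _ ≤ A * (n * r ^ 4) + A * r ^ 2 := by
        gcongr
        · have : 0 ≤ C + C / ε + C / ε ^ 2 := by positivity
          linarith
        · have : 0 ≤ C + R / ε ^ 4 := by positivity
          linarith
    _ = A * (r ^ 2 + n * r ^ 4) := by ring

variable {E : Type*} [NormedAddCommGroup E] [InnerProductSpace ℝ E] [ProperSpace E]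

theorem exists_abs_expect_setsThrough_sub_le {G : E → ℝ} {Ω K : Set E} (hΩ : IsOpen Ω)
    (hK : IsCompact K) (hKΩ : K ⊆ Ω) (hG : ContDiffOn ℝ 2 G Ω) {R : ℝ} (hR : 0 ≤ R) (M : ℝ) :
    ∃ C, ∀ {α : Type*} [Fintype α] [DecidableEq α] (F : α → E) (j : α) (n : ℕ)
      (g : Finset α → ℝ), (∀ k, ‖F k‖ ≤ M) → vecMean univ F ∈ K → 1 ≤ n → n ≤ Fintype.card α →
      (∀ S ∈ setsThrough j n, |g S| ≤ R * n) →
      (∀ S ∈ setsThrough j n, vecMean S F ∈ Ω → g S = G (vecMean S F)) →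
      |𝔼 S ∈ setsThrough j n, g S - G (vecMean univ F)| ≤ C / n := by
  obtain ⟨A, hA, hbound⟩ := exists_global_taylor_remainder_bound hΩ hK hKΩ hG hR
  refine ⟨A * (2 * M + (2 * M) ^ 2 + 4 * (2 * M) ^ 4),
    fun F j n g hF hμ hn hnN hg hgG => ?_⟩
  set μ := vecMean univ F
  obtain ⟨hG'μ, hrem⟩ := hbound μ hμ
  have hdev : ∀ k, ‖F k - μ‖ ≤ 2 * M := fun k => by
    have := norm_vecMean_le ⟨j, mem_univ j⟩ fun k _ => hF k
    linarith [norm_sub_le_of_le (hF k) this]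
  have hM : 0 ≤ 2 * M := (norm_nonneg _).trans (hdev j)
  have hsplit : 𝔼 S ∈ setsThrough j n, g S - G μ
      = 𝔼 S ∈ setsThrough j n, (g S - G μ - fderiv ℝ G μ (vecMean S F - μ))
        + 𝔼 S ∈ setsThrough j n, fderiv ℝ G μ (vecMean S F - μ) := by
    rw [expect_sub_distrib, expect_sub_distrib, expect_const (setsThrough_nonempty j hn hnN)]
    ring
  have hremainder : |𝔼 S ∈ setsThrough j n, (g S - G μ - fderiv ℝ G μ (vecMean S F - μ))|
      ≤ A * ((2 * M) ^ 2 + 4 * (2 * M) ^ 4) / n :=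
    abs_expect_le_of_abs_le_norm_vecMean_sub hdev hn hA
      fun S hS => hrem n _ _ (hg S hS) (hgG S hS)
  have hlinear : |𝔼 S ∈ setsThrough j n, fderiv ℝ G μ (vecMean S F - μ)| ≤ A * (2 * M) / n :=
    (abs_expect_clm_vecMean_sub_le _ hdev j hn).trans (by gcongr)
  rw [hsplit]
  calc _ ≤ A * ((2 * M) ^ 2 + 4 * (2 * M) ^ 4) / n + A * (2 * M) / n :=
        (abs_add_le _ _).trans (add_le_add hremainder hlinear)
    _ = A * (2 * M + (2 * M) ^ 2 + 4 * (2 * M) ^ 4) / n := by ring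

end DeltaMethod

section Moments

/-- Labels of the seven statistics that determine `corrPartial S x y j`: the moments of `x` and `y`
over `S` up to order two, and the two entries `x j` and `y j`. -/
inductive Moment
  | x | y | xx | yy | xy | xj | yj
  deriving DecidableEq

instance : Fintype Moment where
  elems := {.x, .y, .xx, .yy, .xy, .xj, .yj}
  complete i := by cases i <;> decide

/-- The contribution of the index `k` to the statistics labelled by `Moment`, whose mean over `S`
is the vector of statistics. The entries `x j` and `y j` enter as constant functions of `k`. -/
noncomputable def features {ι : Type*} (x y : ι → ℝ) (j k : ι) : EuclideanSpace ℝ Moment :=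
  WithLp.toLp 2 fun
    | .x => x k
    | .y => y k
    | .xx => x k * x k
    | .yy => y k * y k
    | .xy => x k * y k
    | .xj => x j
    | .yj => y j

/-- `#S * corrPartial S x y j` as a function of the seven statistics. -/
noncomputable def scaledPartial (m : EuclideanSpace ℝ Moment) : ℝ :=
  ((m .yj - m .y) - (m .xy - m .x * m .y) / (m .xx - m .x * m .x) * (m .xj - m .x)) /
    √((m .xx - m .x * m .x) * (m .yy - m .y * m .y))

variable {ι : Type*} {x y : ι → ℝ}

theorem vecMean_features_apply (S : Finset ι) (x y : ι → ℝ) (j : ι) (i : Moment) :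
    vecMean S (features x y j) i = mean S fun k => features x y j k i := by
  simp [vecMean, mean, div_eq_inv_mul]

theorem vecMean_features_var_x (S : Finset ι) (x y : ι → ℝ) (j : ι) :
    vecMean S (features x y j) .xx
      - vecMean S (features x y j) .x * vecMean S (features x y j) .x = cov S x x := by
  simp only [vecMean_features_apply, features, cov_eq_mean_mul_sub]

theorem vecMean_features_var_y (S : Finset ι) (x y : ι → ℝ) (j : ι) :
    vecMean S (features x y j) .yy
      - vecMean S (features x y j) .y * vecMean S (features x y j) .y = cov S y y := by
  simp only [vecMean_features_apply, features, cov_eq_mean_mul_sub]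

theorem scaledPartial_vecMean_features [DecidableEq ι] {S : Finset ι} (hx : 0 < cov S x x) {j : ι}
    (hj : j ∈ S) (y : ι → ℝ) :
    scaledPartial (vecMean S (features x y j)) = #S * corrPartial S x y j := by
  have hconst : ∀ c : ℝ, mean S (fun _ => c) = c := fun c => by
    rw [mean_eq_expect, expect_const ⟨j, hj⟩]
  rw [corrPartial_eq hx hj, scaledPartial, vecMean_features_var_x, vecMean_features_var_y]
  simp only [vecMean_features_apply, features, cov_eq_mean_mul_sub S x y, hconst]

theorem norm_features_le {B : ℝ} (hx : ∀ k, |x k| ≤ B) (hy : ∀ k, |y k| ≤ B) (j k : ι) :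
    ‖features x y j k‖ ≤ √7 * (B + B ^ 2) := by
  have hB : 0 ≤ B := (abs_nonneg _).trans (hx j)
  have hlin : ∀ s : ℝ, |s| ≤ B → |s| ≤ B + B ^ 2 := fun s hs => by linarith [sq_nonneg B]
  have hmul : ∀ s t : ℝ, |s| ≤ B → |t| ≤ B → |s * t| ≤ B + B ^ 2 := fun s t hs ht => by
    rw [abs_mul]
    linarith [mul_le_mul hs ht (abs_nonneg _) hB]
  have hentry : ∀ i, ‖features x y j k i‖ ≤ B + B ^ 2 := by
    rintro (_ | _ | _ | _ | _ | _ | _)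
    exacts [hlin _ (hx k), hlin _ (hy k), hmul _ _ (hx k) (hx k), hmul _ _ (hy k) (hy k),
      hmul _ _ (hx k) (hy k), hlin _ (hx j), hlin _ (hy j)]
  calc ‖features x y j k‖ ≤ √(∑ _i : Moment, (B + B ^ 2) ^ 2) := by
        rw [EuclideanSpace.norm_eq]
        gcongr with i
        exact hentry i
    _ = √7 * (B + B ^ 2) := by
        rw [sum_const, card_univ, nsmul_eq_mul, Real.sqrt_mul (Nat.cast_nonneg _),
          Real.sqrt_sq (by positivity)]
        rfl

theorem isOpen_setOf_variances_pos :
    IsOpen {m : EuclideanSpace ℝ Moment |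
      0 < m .xx - m .x * m .x ∧ 0 < m .yy - m .y * m .y} := by
  rw [Set.ofPred_and]
  exact (isOpen_lt (by fun_prop) (by fun_prop)).inter (isOpen_lt (by fun_prop) (by fun_prop))

theorem isCompact_setOf_le_variances (M v : ℝ) :
    IsCompact {m : EuclideanSpace ℝ Moment |
      ‖m‖ ≤ M ∧ v ≤ m .xx - m .x * m .x ∧ v ≤ m .yy - m .y * m .y} := by
  refine (isCompact_closedBall (0 : EuclideanSpace ℝ Moment) M).of_isClosed_subset ?_
    fun m hm => mem_closedBall_zero_iff.2 hm.1
  simp only [Set.ofPred_and]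
  exact (isClosed_le (by fun_prop) (by fun_prop)).inter
    ((isClosed_le (by fun_prop) (by fun_prop)).inter (isClosed_le (by fun_prop) (by fun_prop)))

theorem contDiffOn_scaledPartial {r : WithTop ℕ∞} :
    ContDiffOn ℝ r scaledPartial {m | 0 < m .xx - m .x * m .x ∧ 0 < m .yy - m .y * m .y} := by
  rintro m ⟨hx, hy⟩
  have hcoord : ∀ i, ContDiffAt ℝ r (fun m : EuclideanSpace ℝ Moment => m i) m := fun i => by
    fun_prop
  have hvar := (hcoord .xx).sub ((hcoord .x).mul (hcoord .x))
  have hsqrt := (hvar.mul ((hcoord .yy).sub ((hcoord .y).mul (hcoord .y)))).sqrt (mul_pos hx hy).ne'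
  have hslope := ((hcoord .xy).sub ((hcoord .x).mul (hcoord .y))).div hvar hx.ne'
  exact ((((hcoord .yj).sub (hcoord .y)).sub (hslope.mul ((hcoord .xj).sub (hcoord .x)))).div hsqrt
    (Real.sqrt_pos.2 (mul_pos hx hy)).ne').contDiffWithinAt

theorem exists_abs_expect_corrPartial_sub_le (B : ℝ) {σ δ : ℝ} (hσ : 0 < σ) (hδ : 0 < δ) :
    ∃ C, ∀ {α : Type*} [Fintype α] [DecidableEq α] {x y : α → ℝ},
      (∀ k, |x k| ≤ B) → (∀ k, |y k| ≤ B) → σ ^ 2 ≤ cov univ x x → σ ^ 2 ≤ cov univ y y →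
      (∀ a b, x a ≠ x b → δ ≤ |x a - x b|) →
      ∀ (j : α) {n : ℕ}, 1 ≤ n → n ≤ Fintype.card α →
        |n * 𝔼 S ∈ setsThrough j n, corrPartial S x y j
          - Fintype.card α * corrPartial univ x y j| ≤ C / n := by
  have hσ2 : 0 < σ ^ 2 := by positivity
  obtain ⟨C, hC⟩ := exists_abs_expect_setsThrough_sub_le isOpen_setOf_variances_pos
    (isCompact_setOf_le_variances (√7 * (B + B ^ 2)) (σ ^ 2))
    (fun m hm => ⟨hσ2.trans_le hm.2.1, hσ2.trans_le hm.2.2⟩) contDiffOn_scaledPartial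
    (show 0 ≤ 2 / δ by positivity) (√7 * (B + B ^ 2))
  refine ⟨C, fun {α} _ _ {x y} hx hy hvx hvy hsep j n hn hnN => ?_⟩
  have hfeatures := norm_features_le hx hy j
  rw [mul_expect, ← card_univ, ← scaledPartial_vecMean_features (hσ2.trans_le hvx) (mem_univ j)]
  refine hC _ j n _ hfeatures ⟨?_, ?_, ?_⟩ hn hnN (fun S _ => ?_) fun S hS hpos => ?_
  · exact norm_vecMean_le ⟨j, mem_univ j⟩ fun k _ => hfeatures k
  · rwa [vecMean_features_var_x]
  · rwa [vecMean_features_var_y]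
  · rw [abs_mul, Nat.abs_cast, mul_comm]
    gcongr
    exact abs_corrPartial_le hδ (fun a _ b _ => hsep a b) y j
  · obtain ⟨hcard, hj⟩ := mem_setsThrough.1 hS
    have hxS : 0 < cov S x x := by rw [← vecMean_features_var_x S x y j]; exact hpos.1
    rw [scaledPartial_vecMean_features hxS hj, hcard]

end Moments

section Loss

theorem deriv_comp_update {ι : Type*} [DecidableEq ι] (f : (ι → ℝ) → ℝ) (x : ι → ℝ) (j : ι) :
    deriv (fun t => f (Function.update x j t)) (x j) = lineDeriv ℝ f x (Pi.single j 1) := by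
  have hupdate : ∀ t, Function.update x j t = x + (t - x j) • Pi.single j 1 := fun t => by
    ext k
    rcases eq_or_ne k j with rfl | hk
    · simp
    · simp [hk]
  simp only [hupdate, lineDeriv]
  simpa using deriv_comp_sub_const (fun t => f (x + t • Pi.single j 1)) (x j) (x j)

theorem expect_eq_mul_expect_setsThrough {N n : ℕ} (hn : 1 ≤ n) (hnN : n ≤ N) (j : Fin N)
    {f : Finset (Fin N) → ℝ} (hf : ∀ S, j ∉ S → f S = 0) :
    SampleCorr.expect n f = n / N * 𝔼 S ∈ setsThrough j n, f S := by
  have hN : (N : ℝ) ≠ 0 := by exact_mod_cast Nat.one_le_iff_ne_zero.1 (hn.trans hnN)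
  have hchoose : (N.choose n : ℝ) ≠ 0 := by exact_mod_cast (Nat.choose_pos hnN).ne'
  have hcard : N * (#(setsThrough j n) : ℝ) = n * N.choose n := by
    exact_mod_cast Fintype.card_fin N ▸ card_mul_card_setsThrough j hn
  have hcard0 : (#(setsThrough j n) : ℝ) ≠ 0 := by
    exact_mod_cast (setsThrough_nonempty j hn (hnN.trans_eq (Fintype.card_fin N).symm)).card_ne_zero
  have hsum : ∑ S ∈ powersetCard n univ, f S = ∑ S ∈ setsThrough j n, f S :=
    (sum_filter_of_ne fun S _ hS => not_not.1 fun hj => hS (hf S hj)).symm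
  rw [SampleCorr.expect, hsum, expect_eq_sum_div_card]
  field_simp
  linear_combination (∑ S ∈ setsThrough j n, f S) * hcard

variable {NU NI : ℕ}

theorem fullLoss_eq_sampleLoss (P Y : Fin NU → Fin NI → ℝ) :
    fullLoss P Y = sampleLoss univ univ P Y := by
  rw [fullLoss, sampleLoss, card_univ, Fintype.card_fin]

theorem differentiableAt_sampleLoss {SU : Finset (Fin NU)} {SI : Finset (Fin NI)}
    {P : Fin NU → Fin NI → ℝ} (hP : ∀ i ∈ SU, 0 < cov SI (P i) (P i)) (Y : Fin NU → Fin NI → ℝ) :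
    DifferentiableAt ℝ (fun Q => sampleLoss SU SI Q Y) P := by
  simp only [sampleLoss, div_eq_mul_inv]
  refine (DifferentiableAt.fun_sum fun i hi => DifferentiableAt.const_sub ?_ 1).mul_const _
  exact (differentiableAt_corr (hP i hi) (Y i)).comp P (f := fun Q => Q i) (by fun_prop)

theorem grad_sampleLoss_of_notMem {SU : Finset (Fin NU)} {i : Fin NU} (hi : i ∉ SU)
    (SI : Finset (Fin NI)) (P Y : Fin NU → Fin NI → ℝ) (j : Fin NI) :
    grad j (fun Q => sampleLoss SU SI Q Y) P i = 0 := by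
  have hconst : ∀ v, sampleLoss SU SI (Function.update P i v) Y = sampleLoss SU SI P Y := by
    intro v
    rw [sampleLoss, sampleLoss]
    congr 1
    exact sum_congr rfl fun k hk => by rw [Function.update_of_ne (ne_of_mem_of_not_mem hk hi)]
  simp only [grad, hconst, deriv_const]

theorem grad_sampleLoss_of_mem {SU : Finset (Fin NU)} {i : Fin NU} (hi : i ∈ SU)
    (SI : Finset (Fin NI)) (P Y : Fin NU → Fin NI → ℝ) (j : Fin NI) :
    grad j (fun Q => sampleLoss SU SI Q Y) P i = -corrPartial SI (P i) (Y i) j / #SU := by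
  have hsplit : ∀ v, sampleLoss SU SI (Function.update P i v) Y
      = (1 - corr SI v (Y i) + ∑ k ∈ SU.erase i, (1 - corr SI (P k) (Y k))) / #SU := fun v => by
    rw [sampleLoss, ← add_sum_erase SU _ hi, Function.update_self]
    congr 2
    exact sum_congr rfl fun k hk => by rw [Function.update_of_ne (ne_of_mem_erase hk)]
  simp only [grad, hsplit, deriv_div_const, deriv_add_const, deriv_const_sub]
  rw [deriv_comp_update (corr SI · (Y i)), corrPartial]

theorem grad_fullLoss (P Y : Fin NU → Fin NI → ℝ) (j : Fin NI) (i : Fin NU) :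
    grad j (fun Q => fullLoss Q Y) P i = -corrPartial univ (P i) (Y i) j / NU := by
  simp only [fullLoss_eq_sampleLoss]
  rw [grad_sampleLoss_of_mem (mem_univ i), card_univ, Fintype.card_fin]

theorem expect_expect_grad_sampleLoss (P Y : Fin NU → Fin NI → ℝ) {m n : ℕ} (hm : 1 ≤ m)
    (hmN : m ≤ NU) (hn : 1 ≤ n) (hnN : n ≤ NI) (j : Fin NI) (i : Fin NU) :
    SampleCorr.expect m (fun SU => SampleCorr.expect n fun SI =>
        grad j (fun Q => sampleLoss SU SI Q Y) P i)
      = -(n * 𝔼 SI ∈ setsThrough j n, corrPartial SI (P i) (Y i) j) / (NU * NI) := by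
  have hm0 : (m : ℝ) ≠ 0 := by exact_mod_cast Nat.one_le_iff_ne_zero.1 hm
  have hitems : ∀ SU ∈ setsThrough i m,
      (SampleCorr.expect n fun SI => grad j (fun Q => sampleLoss SU SI Q Y) P i)
        = -(n / NI * 𝔼 SI ∈ setsThrough j n, corrPartial SI (P i) (Y i) j) / m := fun SU hSU => by
    obtain ⟨hcard, hi⟩ := mem_setsThrough.1 hSU
    simp only [grad_sampleLoss_of_mem hi, hcard]
    rw [expect_eq_mul_expect_setsThrough hn hnN j fun S hS => by
      rw [corrPartial_of_notMem hS, neg_zero, zero_div], ← expect_div, expect_neg_distrib]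
    ring
  rw [expect_eq_mul_expect_setsThrough hm hmN i fun SU hi => by
      simp [grad_sampleLoss_of_notMem hi, SampleCorr.expect],
    expect_congr rfl hitems, expect_const (setsThrough_nonempty i hm (by simpa using hmN))]
  field_simp

theorem expect_expect_grad_sampleLoss_sub_grad_fullLoss (P Y : Fin NU → Fin NI → ℝ) {m n : ℕ}
    (hm : 1 ≤ m) (hmN : m ≤ NU) (hn : 1 ≤ n) (hnN : n ≤ NI) (j : Fin NI) (i : Fin NU) :
    SampleCorr.expect m (fun SU => SampleCorr.expect n fun SI =>
        grad j (fun Q => sampleLoss SU SI Q Y) P i) - grad j (fun Q => fullLoss Q Y) P i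
      = -(n * 𝔼 SI ∈ setsThrough j n, corrPartial SI (P i) (Y i) j
          - NI * corrPartial univ (P i) (Y i) j) / (NU * NI) := by
  have hNI : (NI : ℝ) ≠ 0 := by exact_mod_cast Nat.one_le_iff_ne_zero.1 (hn.trans hnN)
  rw [expect_expect_grad_sampleLoss P Y hm hmN hn hnN, grad_fullLoss]
  field_simp
  ring

end Loss

end SampleCorr

theorem mainTheorem1 (B σ δ : ℝ) (hσ : 0 < σ) (hδ : 0 < δ) :
    ∃ C : ℝ, ∀ (NU NI : ℕ) (P Y : Fin NU → Fin NI → ℝ),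
      (∀ i j, |P i j| ≤ B) →
      (∀ i j, |Y i j| ≤ B) →
      (∀ i, σ ^ 2 ≤ SampleCorr.variance (P i)) →
      (∀ i, σ ^ 2 ≤ SampleCorr.variance (Y i)) →
      (∀ i a b, P i a ≠ P i b → δ ≤ |P i a - P i b|) →
      DifferentiableAt ℝ (fun Q => SampleCorr.fullLoss Q Y) P ∧
      (∀ (SU : Finset (Fin NU)) (SI : Finset (Fin NI)),
        (∀ i ∈ SU, ∃ a ∈ SI, ∃ b ∈ SI, P i a ≠ P i b) →
        DifferentiableAt ℝ (fun Q => SampleCorr.sampleLoss SU SI Q Y) P) ∧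
      ∀ (m n : ℕ), 1 ≤ m → m ≤ NU → 1 ≤ n → n ≤ NI →
        ∀ (j : Fin NI) (i : Fin NU),
          |SampleCorr.expect m (fun SU => SampleCorr.expect n (fun SI =>
              SampleCorr.grad j (fun Q => SampleCorr.sampleLoss SU SI Q Y) P i))
            - SampleCorr.grad j (fun Q => SampleCorr.fullLoss Q Y) P i|
          ≤ C / ((NU : ℝ) * (NI : ℝ) * (n : ℝ)) := by
  obtain ⟨C, hC⟩ := SampleCorr.exists_abs_expect_corrPartial_sub_le B hσ hδ
  refine ⟨C, fun NU NI P Y hP hY hvP hvY hsep => ?_⟩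
  simp only [SampleCorr.variance_eq_cov_self] at hvP hvY
  refine ⟨?_, fun SU SI hSI => ?_, fun m n hm hmN hn hnN j i => ?_⟩
  · simp only [SampleCorr.fullLoss_eq_sampleLoss]
    exact SampleCorr.differentiableAt_sampleLoss (fun i _ => (pow_pos hσ 2).trans_le (hvP i)) Y
  · refine SampleCorr.differentiableAt_sampleLoss (fun i hi => ?_) Y
    obtain ⟨a, ha, b, hb, hab⟩ := hSI i hi
    exact SampleCorr.cov_self_pos_of_ne ha hb hab
  · have hbias := hC (hP i) (hY i) (hvP i) (hvY i) (hsep i) j hn (by simpa using hnN)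
    rw [Fintype.card_fin] at hbias
    rw [SampleCorr.expect_expect_grad_sampleLoss_sub_grad_fullLoss P Y hm hmN hn hnN, abs_div,
      abs_neg, abs_of_nonneg (a := (NU : ℝ) * NI) (by positivity), mul_comm _ (n : ℝ), ← div_div C]
    exact div_le_div_of_nonneg_right hbias (by positivity)
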